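/- Consider an instance $(S,T,r,p,l)$ of the rectilinear Steiner tree problem with given topology and length restrictions: $S$ is a finite tree, $T\subseteq V(S)$ is a set of terminals with positions $p:T\to\mathbb{R}^2$, $r\in T$ is the root, and $l_t\ge 0$ for $t\in T$ are length restrictions. Assume that the instance is integral, i.e. $p(t)\in\mathbb{Z}^2$ and $l_t\in\mathbb{Z}$ for all $t\in T$. A (feasible) embedding is a map $\pi:V(S)\to\mathbb{R}^2$ with $\pi(t)=p(t)$ for all $t\in T$ such that, for every $t\in T$, $$\sum_{\{v,w\}\in E_S[r,t]}\|\pi(v)-\pi(w)\|_1\le l_t ,$$ where $E_S[r,t]$ is the edge set of the unique $r$-$t$ path in $S$. Its cost is $c(\pi)=\sum_{\{v,w\}\in E(S)}\|\pi(v)-\pi(w)\|_1$; it is optimal if its cost is minimum among all feasible embeddings, and half-integral if $2\pi(v)\in\mathbb{Z}^2$ for all $v\in V(S)$. Lemma. If $\pi$ is a half-integral feasible embedding that is not optimal, then there exists a half-integral feasible embedding $\pi'$ with $\pi(v)-\pi'(v)\in\{-0.5,0,0.5\}^2$ for all $v\in V(S)$ and $c(\pi')\le c(\pi)-0.5$.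 -/

import Mathlib

/-- The `ℓ₁` norm `|x| + |y|` of a point `(x, y)` of the plane. -/
def l1Norm (q : ℝ × ℝ) : ℝ := |q.1| + |q.2|

theorem l1Norm_sub_comm (q q' : ℝ × ℝ) : l1Norm (q - q') = l1Norm (q' - q) := by
  simp [l1Norm, abs_sub_comm]

/-- The length `‖π v - π w‖₁` of an edge `{v, w}` when the vertices are placed by `π`. -/
def edgeLength {V : Type*} (π : V → ℝ × ℝ) : Sym2 V → ℝ :=
  Sym2.lift ⟨fun v w => l1Norm (π v - π w), fun v w => l1Norm_sub_comm (π v) (π w)⟩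

/-- An input `(S, T, r, p, l)` of the rectilinear Steiner tree problem with given topology and
length restrictions: a tree `S` on the vertex set `V`, a set `T` of terminals with positions `p`
in the plane, a root `r ∈ T`, and length restrictions `l t ≥ 0` for the terminals. -/
structure SteinerInstance (V : Type*) where
  S : SimpleGraph V
  isTree : S.IsTree
  T : Set V
  r : V
  r_mem : r ∈ T
  p : T → ℝ × ℝ
  l : T → ℝ
  l_nonneg : ∀ t, 0 ≤ l t

namespace SteinerInstance

variable {V : Type*} (I : SteinerInstance V)

/-- The unique path of the tree from the root to `v`. -/
noncomputable def rootPath (v : V) : I.S.Walk I.r v :=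
  (I.isTree.existsUnique_path I.r v).choose

/-- The length `d_π(v)` of the unique path from the root to `v`. -/
noncomputable def pathLength (π : V → ℝ × ℝ) (v : V) : ℝ :=
  ((I.rootPath v).edges.map (edgeLength π)).sum

/-- The total length `c(π)`: the sum of the lengths of all edges of the tree. -/
noncomputable def cost [Finite V] (π : V → ℝ × ℝ) : ℝ :=
  ∑ e ∈ (Set.toFinite I.S.edgeSet).toFinset, edgeLength π e

/-- `π` is a (feasible) embedding: terminals are at their prescribed positions and all length
restrictions are satisfied. -/
def IsFeasible (π : V → ℝ × ℝ) : Prop :=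
  (∀ t : I.T, π t = I.p t) ∧ ∀ t : I.T, I.pathLength π t ≤ I.l t

/-- `π` is an optimal embedding: feasible, and of minimum total length among all feasible
embeddings into the plane. -/
def IsOptimal [Finite V] (π : V → ℝ × ℝ) : Prop :=
  I.IsFeasible π ∧ ∀ σ : V → ℝ × ℝ, I.IsFeasible σ → I.cost π ≤ I.cost σ

/-- The instance is integral: all terminal positions and all length restrictions are integral. -/
def IsIntegral : Prop :=
  (∀ t : I.T, ∃ m n : ℤ, I.p t = ((m : ℝ), (n : ℝ))) ∧ ∀ t : I.T, ∃ k : ℤ, I.l t = (k : ℝ)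

end SteinerInstance

/-- Every vertex is at a position both of whose coordinates are integer multiples of `1/2`. -/
def IsHalfIntegral {V : Type*} (π : V → ℝ × ℝ) : Prop :=
  ∀ v, ∃ m n : ℤ, π v = ((m : ℝ) / 2, (n : ℝ) / 2)

/-! ### The tree rooted at `r`. -/

namespace SteinerInstance

variable {V : Type*} (I : SteinerInstance V)

/-! Accumulate along each root path the right, up, left and down steps, in units of 1/2, with
vertical sums negated. Positions are then differences of two potentials. At a terminal, whose
displacement is fixed, the length restriction also bounds a difference of two potentials. So
feasibility becomes a system of difference constraints with integral bounds, and the cost becomes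
linear (`IsFeasiblePotential`, `totalTravel`). For such a system a better real solution yields a
better integral one, reached by moving some coordinates by one in a common direction
(`exists_unit_descent`). Each position coordinate, half a difference of two potentials, then changes
by at most 1/2. The objective is integral and equals twice the cost at the old embedding, so the
cost drops by at least 1/2. -/

theorem rootPath_isPath (v : V) : (I.rootPath v).IsPath :=
  (I.isTree.existsUnique_path I.r v).choose_spec.1

theorem eq_rootPath {v : V} {q : I.S.Walk I.r v} (hq : q.IsPath) : q = I.rootPath v :=
  (I.isTree.existsUnique_path I.r v).choose_spec.2 q hq

theorem rootPath_root : I.rootPath I.r = .nil :=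
  (I.eq_rootPath .nil).symm

/-- `a` is the parent of `b` when the tree is rooted at `r`. -/
def IsParent (a b : V) : Prop :=
  ∃ h : I.S.Adj a b, I.rootPath b = (I.rootPath a).concat h

theorem isParent_or_isParent {a b : V} (h : I.S.Adj a b) : I.IsParent a b ∨ I.IsParent b a := by
  by_cases hb : b ∈ (I.rootPath a).support
  · exact .inr ⟨h.symm, I.isTree.isAcyclic.path_concat (I.rootPath_isPath b)
      (I.rootPath_isPath a) h.symm hb⟩
  · exact .inl ⟨h, (I.eq_rootPath ((I.rootPath_isPath a).concat hb h)).symm⟩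

theorem exists_isParent {v : V} (hv : v ≠ I.r) : ∃ a, I.IsParent a v := by
  have hn : ¬ (I.rootPath v).Nil := SimpleGraph.Walk.not_nil_of_ne hv.symm
  refine ⟨(I.rootPath v).penultimate, (I.rootPath v).adj_penultimate hn, ?_⟩
  rw [← I.eq_rootPath (I.rootPath_isPath v).dropLast]
  exact ((I.rootPath v).concat_dropLast (SimpleGraph.Walk.adj_penultimate hn)).symm

/-- Induction along the tree, away from the root. -/
theorem induction_isParent {P : V → Prop} (root : P I.r)
    (step : ∀ a b, I.IsParent a b → P a → P b) (v : V) : P v := by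
  induction hn : (I.rootPath v).length using Nat.strong_induction_on generalizing v with
  | _ n ih =>
    by_cases hv : v = I.r
    · rwa [hv]
    · obtain ⟨a, ha⟩ := I.exists_isParent hv
      refine step a v ha (ih _ ?_ a rfl)
      obtain ⟨h, e⟩ := ha
      rw [← hn, e, SimpleGraph.Walk.length_concat]
      exact Nat.lt_succ_self _

theorem exists_orientation :
    ∃ f : I.S.edgeSet → V × V, ∀ e, s((f e).1, (f e).2) = e.1 ∧ I.IsParent (f e).1 (f e).2 := by
  have (e : I.S.edgeSet) : ∃ q : V × V, s(q.1, q.2) = e.1 ∧ I.IsParent q.1 q.2 := by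
    obtain ⟨e, he⟩ := e
    induction e using Sym2.ind with
    | _ a b =>
      rcases I.isParent_or_isParent he with h | h
      · exact ⟨(a, b), rfl, h⟩
      · exact ⟨(b, a), Sym2.eq_swap, h⟩
  choose f hf using this
  exact ⟨f, hf⟩

theorem pathLength_root (π : V → ℝ × ℝ) : I.pathLength π I.r = 0 := by
  simp [pathLength, rootPath_root]

theorem pathLength_of_isParent (π : V → ℝ × ℝ) {a b : V} (h : I.IsParent a b) :
    I.pathLength π b = I.pathLength π a + l1Norm (π a - π b) := by
  obtain ⟨h, e⟩ := h
  simp [pathLength, e, edgeLength]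

/-! ### Encoding embeddings by four potentials. -/

/-- The potential whose increments from parents to children are given by `g`. -/
noncomputable def potential (g : V → V → ℝ) (v : V) : ℝ :=
  ((I.rootPath v).darts.map fun d => g d.fst d.snd).sum

theorem potential_root (g : V → V → ℝ) : I.potential g I.r = 0 := by
  simp [potential, rootPath_root]

theorem potential_of_isParent (g : V → V → ℝ) {a b : V} (h : I.IsParent a b) :
    I.potential g b = I.potential g a + g a b := by
  obtain ⟨h, e⟩ := h
  simp [potential, e]

/-- The displacement from the root encoded by four potentials: `0` and `2` accumulate the steps to
the right and to the left, `1` and `3` the negatives of the steps upwards and downwards. -/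
def displacement (z : Fin 4 × V → ℝ) (v : V) : ℝ × ℝ :=
  (z (0, v) - z (2, v), z (3, v) - z (1, v))

/-- The distance travelled from the root, encoded by the same four potentials. -/
def travel (z : Fin 4 × V → ℝ) (v : V) : ℝ :=
  z (0, v) + z (2, v) - z (1, v) - z (3, v)

/-- The steps in the four axis directions, in units of `1/2`. -/
def axisStep (π : V → ℝ × ℝ) (k : Fin 4) (a b : V) : ℝ :=
  ![max (2 * (π b).1 - 2 * (π a).1) 0, -max (2 * (π b).2 - 2 * (π a).2) 0,
    max (2 * (π a).1 - 2 * (π b).1) 0, -max (2 * (π a).2 - 2 * (π b).2) 0] k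

/-- The four potentials of an embedding, which accumulate its axis steps along the root paths. -/
noncomputable def axisPotential (π : V → ℝ × ℝ) (i : Fin 4 × V) : ℝ :=
  I.potential (axisStep π i.1) i.2

theorem axisPotential_root (π : V → ℝ × ℝ) (k : Fin 4) : I.axisPotential π (k, I.r) = 0 :=
  I.potential_root _

theorem axisPotential_of_isParent (π : V → ℝ × ℝ) (k : Fin 4) {a b : V} (h : I.IsParent a b) :
    I.axisPotential π (k, b) = I.axisPotential π (k, a) + axisStep π k a b :=
  I.potential_of_isParent _ h

theorem max_zero_sub_max_zero (x y : ℝ) : max (2 * x - 2 * y) 0 - max (2 * y - 2 * x) 0 =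
    2 * (x - y) := by
  rcases le_total x y with h | h
  · rw [max_eq_right (by linarith), max_eq_left (by linarith)]; ring
  · rw [max_eq_left (by linarith), max_eq_right (by linarith)]; ring

theorem max_zero_add_max_zero (x y : ℝ) : max (2 * x - 2 * y) 0 + max (2 * y - 2 * x) 0 =
    2 * |y - x| := by
  rcases le_total x y with h | h
  · rw [max_eq_right (by linarith), max_eq_left (by linarith), abs_of_nonneg (by linarith)]; ring
  · rw [max_eq_left (by linarith), max_eq_right (by linarith), abs_of_nonpos (by linarith)]; ring

theorem displacement_axisPotential (π : V → ℝ × ℝ) (v : V) :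
    displacement (I.axisPotential π) v = (2 * ((π v).1 - (π I.r).1), 2 * ((π v).2 - (π I.r).2)) := by
  induction v using I.induction_isParent with
  | root => simp [displacement, axisPotential_root]
  | step a b h ih =>
    simp only [displacement, Prod.mk.injEq, I.axisPotential_of_isParent π _ h] at ih ⊢
    have h1 := max_zero_sub_max_zero (π b).1 (π a).1
    have h2 := max_zero_sub_max_zero (π b).2 (π a).2
    simp only [axisStep, Matrix.cons_val]
    constructor <;> linarith [ih.1, ih.2]

theorem travel_axisPotential_of_isParent (π : V → ℝ × ℝ) {a b : V} (h : I.IsParent a b) :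
    travel (I.axisPotential π) b - travel (I.axisPotential π) a = 2 * l1Norm (π a - π b) := by
  simp only [travel, I.axisPotential_of_isParent π _ h]
  have h1 := max_zero_add_max_zero (π b).1 (π a).1
  have h2 := max_zero_add_max_zero (π b).2 (π a).2
  simp only [axisStep, Matrix.cons_val, l1Norm, Prod.fst_sub, Prod.snd_sub]
  linarith

theorem travel_axisPotential (π : V → ℝ × ℝ) (v : V) :
    travel (I.axisPotential π) v = 2 * I.pathLength π v := by
  induction v using I.induction_isParent with
  | root => simp [travel, axisPotential_root, pathLength_root]
  | step a b h ih =>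
    rw [I.pathLength_of_isParent π h]
    linarith [I.travel_axisPotential_of_isParent π h]

theorem exists_int_axisPotential {π : V → ℝ × ℝ} (hπ : IsHalfIntegral π) (i : Fin 4 × V) :
    ∃ n : ℤ, I.axisPotential π i = n := by
  obtain ⟨k, v⟩ := i
  induction v using I.induction_isParent with
  | root => exact ⟨0, by simp [axisPotential_root]⟩
  | step a b h ih =>
    obtain ⟨n, hn⟩ := ih
    obtain ⟨m₁, n₁, h₁⟩ := hπ a
    obtain ⟨m₂, n₂, h₂⟩ := hπ b
    refine ⟨n + ![max (m₂ - m₁) 0, -max (n₂ - n₁) 0, max (m₁ - m₂) 0, -max (n₁ - n₂) 0] k, ?_⟩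
    rw [I.axisPotential_of_isParent π k h, hn, axisStep, h₁, h₂]
    fin_cases k <;> simp [mul_div_cancel₀]

end SteinerInstance

/-! ### Descent under difference constraints. -/

/-- Layer-cake decomposition: a nonnegative `d` is a nonnegative combination of indicators of its
superlevel sets. Subtracting the least positive value on the support shrinks the support and only
shifts the thresholds. -/
theorem LinearMap.nonneg_of_superlevel {ι : Type*} [Finite ι] (L : (ι → ℝ) →ₗ[ℝ] ℝ) (d : ι → ℝ)
    (hd : 0 ≤ d) (h : ∀ θ > 0, 0 ≤ L (Set.indicator {i | θ ≤ d i} 1)) : 0 ≤ L d := by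
  induction hn : {i | 0 < d i}.ncard using Nat.strong_induction_on generalizing d with
  | _ n ih =>
    by_cases he : {i | 0 < d i}.Nonempty
    · obtain ⟨j, hj, hmin⟩ := Set.exists_min_image {i | 0 < d i} d (Set.toFinite _) he
      have hdec : d = (d - d j • Set.indicator {i | d j ≤ d i} 1) +
          d j • Set.indicator {i | d j ≤ d i} (1 : ι → ℝ) := by simp
      have hval (i) : (d - d j • Set.indicator {i | d j ≤ d i} (1 : ι → ℝ)) i =
          if 0 < d i then d i - d j else 0 := by
        by_cases hi : 0 < d i
        · have : d j ≤ d i := hmin i hi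
          simp [Set.indicator, hi, this]
        · have h0 : d i = 0 := le_antisymm (not_lt.1 hi) (hd i)
          have : ¬ d j ≤ 0 := not_le.2 hj
          simp [Set.indicator, h0, this]
      generalize d - d j • Set.indicator {i | d j ≤ d i} (1 : ι → ℝ) = d' at hdec hval
      rw [hdec, map_add, map_smul]
      refine add_nonneg (ih _ ?_ d' ?_ ?_ rfl) (mul_nonneg hj.le (h _ hj))
      · rw [← hn]
        refine Set.ncard_lt_ncard ⟨fun i hi => ?_, fun hsub => ?_⟩ (Set.toFinite _)
        · by_contra hc
          rw [Set.mem_ofPred_eq, hval, if_neg (show ¬ 0 < d i from hc)] at hi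
          exact lt_irrefl _ hi
        · have := hsub hj
          simp [hval] at this
      · intro i
        rw [hval]
        split_ifs with hi
        · exact sub_nonneg.2 (hmin i hi)
        · exact le_rfl
      · intro θ hθ
        convert h (θ + d j) (add_pos hθ hj) using 3
        ext i
        rw [Set.mem_ofPred_eq, Set.mem_ofPred_eq, hval]
        split_ifs with hi
        · exact le_sub_iff_add_le
        · have : d i ≤ 0 := not_lt.1 hi
          have : 0 < d j := hj
          constructor <;> intro _ <;> linarith
    · have : d = 0 := funext fun i => le_antisymm (not_lt.1 fun hi => he ⟨i, hi⟩) (hd i)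
      simp [this]

/-- Steepest descent for a linear objective under integral difference constraints: if `q` improves
on the integral point `p`, then so does moving `p` by one along some set of coordinates, and this
move keeps every integral difference constraint which both `p` and `q` satisfy. -/
theorem exists_unit_descent {ι : Type*} [Finite ι] (L : (ι → ℝ) →ₗ[ℝ] ℝ) (p : ι → ℤ) (q : ι → ℝ)
    (hq : L q < L fun i => (p i : ℝ)) :
    ∃ p' : ι → ℤ, (L fun i => (p' i : ℝ)) < (L fun i => (p i : ℝ)) ∧
      ((∀ i, p' i = p i ∨ p' i = p i + 1) ∨ ∀ i, p' i = p i ∨ p' i = p i - 1) ∧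
      ∀ i j (k : ℤ), (p i : ℝ) - p j ≤ k → q i - q j ≤ k → (p' i : ℝ) - p' j ≤ k := by
  classical
  set d : ι → ℝ := fun i => q i - p i with hd
  have hneg : L d < 0 := by
    have : d = q - fun i => (p i : ℝ) := rfl
    rw [this, map_sub]; linarith
  have hsplit : d = d⁺ - d⁻ := (posPart_sub_negPart d).symm
  -- Moving only up or only down towards `q` already improves the objective.
  have hcases : L d⁺ < 0 ∨ L (-d⁻) < 0 := by
    by_contra! hc
    rw [hsplit, sub_eq_add_neg, map_add] at hneg
    linarith [hc.1, hc.2]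
  rcases hcases with hc | hc
  · obtain ⟨θ, hθ, hL⟩ : ∃ θ > 0, L (Set.indicator {i | θ ≤ d⁺ i} 1) < 0 := by
      by_contra! h
      exact absurd (L.nonneg_of_superlevel _ (posPart_nonneg d) h) (not_le.2 hc)
    have hmem (i) : θ ≤ d⁺ i ↔ θ ≤ q i - p i := by
      simp [Pi.posPart_apply, posPart_def, hd, not_le.2 hθ]
    refine ⟨fun i => if θ ≤ q i - p i then p i + 1 else p i, ?_, .inl fun i => ?_, ?_⟩
    · have : (fun i => ((if θ ≤ q i - p i then p i + 1 else p i : ℤ) : ℝ)) =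
          (fun i => (p i : ℝ)) + Set.indicator {i | θ ≤ d⁺ i} 1 := by
        funext i
        simp only [Pi.add_apply, Set.indicator, Set.mem_ofPred_eq, hmem]
        split_ifs <;> simp
      rw [this, map_add]; linarith
    · dsimp only; split_ifs <;> simp
    · intro i j k h1 h2
      have h1' : p i - p j ≤ k := by exact_mod_cast h1
      dsimp only
      -- If the constraint is tight at `p`, then `q i - p i ≤ q j - p j`, so `j` moves whenever `i`
      -- does. Otherwise integrality leaves slack at least 1, enough for one unit move.
      rcases h1'.eq_or_lt with h0 | h0
      · have h0' : (p i : ℝ) - p j = k := by exact_mod_cast h0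
        split_ifs <;> push_cast <;> linarith
      · have h0' : (p i : ℝ) - p j + 1 ≤ k := by exact_mod_cast h0
        split_ifs <;> push_cast <;> linarith
  · obtain ⟨θ, hθ, hL⟩ : ∃ θ > 0, L (-Set.indicator {i | θ ≤ d⁻ i} 1) < 0 := by
      by_contra! h
      exact absurd ((-L).nonneg_of_superlevel _ (negPart_nonneg d) (by simpa using h))
        (by simpa using hc)
    have hmem (i) : θ ≤ d⁻ i ↔ θ ≤ p i - q i := by
      simp [Pi.negPart_apply, negPart_def, hd, not_le.2 hθ]
    refine ⟨fun i => if θ ≤ p i - q i then p i - 1 else p i, ?_, .inr fun i => ?_, ?_⟩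
    · have : (fun i => ((if θ ≤ p i - q i then p i - 1 else p i : ℤ) : ℝ)) =
          (fun i => (p i : ℝ)) + -Set.indicator {i | θ ≤ d⁻ i} 1 := by
        funext i
        simp only [Pi.add_apply, Pi.neg_apply, Set.indicator, Set.mem_ofPred_eq, hmem]
        split_ifs <;> simp [sub_eq_add_neg]
      rw [this, map_add]; linarith
    · dsimp only; split_ifs <;> simp
    · intro i j k h1 h2
      have h1' : p i - p j ≤ k := by exact_mod_cast h1
      dsimp only
      rcases h1'.eq_or_lt with h0 | h0
      · have h0' : (p i : ℝ) - p j = k := by exact_mod_cast h0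
        split_ifs <;> push_cast <;> linarith
      · have h0' : (p i : ℝ) - p j + 1 ≤ k := by exact_mod_cast h0
        split_ifs <;> push_cast <;> linarith

/-! ### Feasibility as a system of difference constraints. -/

namespace SteinerInstance

variable {V : Type*} (I : SteinerInstance V)

/-- The total distance travelled along a family of oriented edges, a linear function of the
potentials. -/
def totalTravel {ε : Type*} [Fintype ε] (f : ε → V × V) : (Fin 4 × V → ℝ) →ₗ[ℝ] ℝ where
  toFun z := ∑ e, (travel z (f e).2 - travel z (f e).1)
  map_add' z w := by
    rw [← Finset.sum_add_distrib]
    refine Finset.sum_congr rfl fun e _ => ?_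
    simp only [travel, Pi.add_apply]; ring
  map_smul' a z := by
    rw [RingHom.id_apply, smul_eq_mul, Finset.mul_sum]
    refine Finset.sum_congr rfl fun e _ => ?_
    simp only [travel, Pi.smul_apply, smul_eq_mul]; ring

theorem totalTravel_intCast {ε : Type*} [Fintype ε] (f : ε → V × V) (p : Fin 4 × V → ℤ) :
    ∃ n : ℤ, totalTravel f (fun i => (p i : ℝ)) = n := by
  refine ⟨∑ e, ((p (0, (f e).2) + p (2, (f e).2) - p (1, (f e).2) - p (3, (f e).2)) -
    (p (0, (f e).1) + p (2, (f e).1) - p (1, (f e).1) - p (3, (f e).1))), ?_⟩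
  push_cast
  rfl

theorem cost_eq_sum [Finite V] [Fintype I.S.edgeSet] {f : I.S.edgeSet → V × V}
    (hf : ∀ e, s((f e).1, (f e).2) = e.1) (π : V → ℝ × ℝ) :
    I.cost π = ∑ e, l1Norm (π (f e).1 - π (f e).2) := by
  rw [cost, Finset.sum_subtype (F := ‹_›) _ (p := (· ∈ I.S.edgeSet)) (by simp) (edgeLength π)]
  refine Finset.sum_congr rfl fun e _ => ?_
  rw [← hf e]
  rfl

/-- Potentials that are monotone along the edges in the sense of the axis steps. -/
def IsMonotone (z : Fin 4 × V → ℝ) : Prop :=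
  ∀ a b, I.IsParent a b → z (0, a) ≤ z (0, b) ∧ z (1, b) ≤ z (1, a) ∧ z (2, a) ≤ z (2, b) ∧
    z (3, b) ≤ z (3, a)

theorem isMonotone_axisPotential (π : V → ℝ × ℝ) : I.IsMonotone (I.axisPotential π) := by
  intro a b h
  simp only [I.axisPotential_of_isParent π _ h, axisStep, Matrix.cons_val]
  refine ⟨?_, ?_, ?_, ?_⟩ <;> simp

/-- The embedding with the displacements of `z`, in units of `1/2`, from the root at `o`. -/
noncomputable def embeddingOf (o : ℝ × ℝ) (z : Fin 4 × V → ℝ) (v : V) : ℝ × ℝ :=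
  (o.1 + (z (0, v) - z (2, v)) / 2, o.2 + (z (3, v) - z (1, v)) / 2)

theorem embeddingOf_axisPotential (π : V → ℝ × ℝ) :
    embeddingOf (π I.r) (I.axisPotential π) = π := by
  funext v
  have h := I.displacement_axisPotential π v
  simp only [displacement, Prod.mk.injEq] at h
  ext
  · simp only [embeddingOf, h.1]; ring
  · simp only [embeddingOf, h.2]; ring

/-- Only an inequality: monotone potentials may record opposite steps on the same edge, which cancel
in the position but not in `travel`. -/
theorem l1Norm_embeddingOf_le {z : Fin 4 × V → ℝ} (hz : I.IsMonotone z) (o : ℝ × ℝ) {a b : V}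
    (h : I.IsParent a b) :
    2 * l1Norm (embeddingOf o z a - embeddingOf o z b) ≤ travel z b - travel z a := by
  obtain ⟨h0, h1, h2, h3⟩ := hz a b h
  have hx : |(embeddingOf o z a - embeddingOf o z b).1| ≤
      (z (0, b) - z (0, a) + (z (2, b) - z (2, a))) / 2 := by
    simp only [embeddingOf, Prod.mk_sub_mk]
    exact abs_le.2 ⟨by linarith, by linarith⟩
  have hy : |(embeddingOf o z a - embeddingOf o z b).2| ≤
      (z (1, a) - z (1, b) + (z (3, a) - z (3, b))) / 2 := by
    simp only [embeddingOf, Prod.mk_sub_mk]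
    exact abs_le.2 ⟨by linarith, by linarith⟩
  simp only [l1Norm, travel]
  linarith

theorem pathLength_embeddingOf_le {z : Fin 4 × V → ℝ} (hz : I.IsMonotone z) (o : ℝ × ℝ) (v : V) :
    2 * I.pathLength (embeddingOf o z) v ≤ travel z v - travel z I.r := by
  induction v using I.induction_isParent with
  | root => simp [pathLength_root]
  | step a b h ih =>
    rw [I.pathLength_of_isParent _ h]
    linarith [I.l1Norm_embeddingOf_le hz o h]

/-- The difference constraints which say that the potentials encode a feasible embedding. -/
structure IsFeasiblePotential (z : Fin 4 × V → ℝ) : Prop where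
  isMonotone : I.IsMonotone z
  -- Equality at the root replaces vanishing there, which is not a difference constraint.
  root : ∀ j k, z (j, I.r) ≤ z (k, I.r)
  terminal : ∀ t : I.T, displacement z t =
    (2 * ((I.p t).1 - (I.p ⟨I.r, I.r_mem⟩).1), 2 * ((I.p t).2 - (I.p ⟨I.r, I.r_mem⟩).2))
  -- This is `travel z t ≤ 2 * I.l t`, halved after eliminating `z (2, t)` and `z (3, t)` through
  -- `terminal`.
  length : ∀ t : I.T, z (0, t) - z (1, t) ≤
    I.l t + ((I.p t).1 - (I.p ⟨I.r, I.r_mem⟩).1) + ((I.p t).2 - (I.p ⟨I.r, I.r_mem⟩).2)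

theorem IsFeasible.isFeasiblePotential {I : SteinerInstance V} {π : V → ℝ × ℝ}
    (h : I.IsFeasible π) : I.IsFeasiblePotential (I.axisPotential π) := by
  have hdisp (t : I.T) := I.displacement_axisPotential π t
  have hr := h.1 ⟨I.r, I.r_mem⟩
  dsimp only at hr
  simp only [h.1, hr] at hdisp
  refine ⟨I.isMonotone_axisPotential π, fun j k => by simp [axisPotential_root], hdisp,
    fun t => ?_⟩
  have h1 := I.travel_axisPotential π t
  have h2 := h.2 t
  have h3 := hdisp t
  simp only [displacement, Prod.mk.injEq] at h3
  simp only [travel] at h1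
  linarith [h3.1, h3.2]

theorem IsFeasiblePotential.isFeasible {I : SteinerInstance V} {z : Fin 4 × V → ℝ}
    (h : I.IsFeasiblePotential z) : I.IsFeasible (embeddingOf (I.p ⟨I.r, I.r_mem⟩) z) := by
  refine ⟨fun t => ?_, fun t => ?_⟩
  · have h3 := h.terminal t
    simp only [displacement, Prod.mk.injEq] at h3
    ext
    · simp only [embeddingOf, h3.1]; ring
    · simp only [embeddingOf, h3.2]; ring
  · have h1 := I.pathLength_embeddingOf_le h.isMonotone (I.p ⟨I.r, I.r_mem⟩) t
    have h2 := h.length t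
    have h3 := h.terminal t
    simp only [displacement, Prod.mk.injEq] at h3
    have h4 : travel z I.r = 0 := by
      have h01 := le_antisymm (h.root 0 1) (h.root 1 0)
      have h23 := le_antisymm (h.root 2 3) (h.root 3 2)
      simp only [travel]; linarith
    rw [h4] at h1
    simp only [travel] at h1
    linarith [h3.1, h3.2]

/-- For an integral instance, feasibility of potentials is inherited through integral difference
constraints. -/
theorem IsFeasiblePotential.of_difference {I : SteinerInstance V} (hI : I.IsIntegral)
    {p q z : Fin 4 × V → ℝ} (hp : I.IsFeasiblePotential p) (hq : I.IsFeasiblePotential q)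
    (h : ∀ i j (k : ℤ), p i - p j ≤ k → q i - q j ≤ k → z i - z j ≤ k) :
    I.IsFeasiblePotential z := by
  have hle (i j) (h1 : p i ≤ p j) (h2 : q i ≤ q j) : z i ≤ z j := by
    have := h i j 0 (by simpa using h1) (by simpa using h2)
    simpa using this
  obtain ⟨mr, nr, hr⟩ := hI.1 ⟨I.r, I.r_mem⟩
  refine ⟨fun a b hab => ?_, fun j k => hle _ _ (hp.root j k) (hq.root j k), fun t => ?_,
    fun t => ?_⟩
  · obtain ⟨p0, p1, p2, p3⟩ := hp.isMonotone a b hab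
    obtain ⟨q0, q1, q2, q3⟩ := hq.isMonotone a b hab
    exact ⟨hle _ _ p0 q0, hle _ _ p1 q1, hle _ _ p2 q2, hle _ _ p3 q3⟩
  · have heq (i j) (k : ℤ) (h1 : p i - p j = k) (h2 : q i - q j = k) : z i - z j = k := by
      refine le_antisymm (h i j k h1.le h2.le) ?_
      have := h j i (-k) (by push_cast; linarith) (by push_cast; linarith)
      push_cast at this
      linarith
    obtain ⟨m, n, ht⟩ := hI.1 t
    have h1 := hp.terminal t
    have h2 := hq.terminal t
    simp only [displacement, Prod.mk.injEq, hr, ht] at h1 h2 ⊢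
    have e1 := heq (0, t) (2, t) (2 * (m - mr)) (by push_cast; exact h1.1)
      (by push_cast; exact h2.1)
    have e2 := heq (3, t) (1, t) (2 * (n - nr)) (by push_cast; exact h1.2)
      (by push_cast; exact h2.2)
    push_cast at e1 e2
    exact ⟨e1, e2⟩
  · obtain ⟨m, n, ht⟩ := hI.1 t
    obtain ⟨l, hl⟩ := hI.2 t
    have h1 := hp.length t
    have h2 := hq.length t
    simp only [hr, ht, hl] at h1 h2 ⊢
    have := h (0, t) (1, t) (l + (m - mr) + (n - nr)) (by push_cast; exact h1)
      (by push_cast; exact h2)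
    push_cast at this
    exact this

theorem isHalfIntegral_embeddingOf {o : ℝ × ℝ} (ho : ∃ m n : ℤ, o = ((m : ℝ), (n : ℝ)))
    (p : Fin 4 × V → ℤ) : IsHalfIntegral (embeddingOf o fun i => (p i : ℝ)) := by
  obtain ⟨m, n, rfl⟩ := ho
  intro v
  refine ⟨2 * m + (p (0, v) - p (2, v)), 2 * n + (p (3, v) - p (1, v)), ?_⟩
  simp only [embeddingOf, Prod.mk.injEq]
  push_cast
  constructor <;> ring

/-- The common direction of the moves matters: opposite moves could change a difference by 2. -/
theorem embeddingOf_sub_mem {o : ℝ × ℝ} {p p' : Fin 4 × V → ℤ}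
    (h : (∀ i, p' i = p i ∨ p' i = p i + 1) ∨ ∀ i, p' i = p i ∨ p' i = p i - 1) (v : V) :
    (embeddingOf o (fun i => (p i : ℝ)) v - embeddingOf o (fun i => (p' i : ℝ)) v) ∈
      ({-1 / 2, 0, 1 / 2} : Set ℝ) ×ˢ ({-1 / 2, 0, 1 / 2} : Set ℝ) := by
  have key (i j) (c : ℝ) : (c + ((p i : ℝ) - p j) / 2) - (c + ((p' i : ℝ) - p' j) / 2) ∈
      ({-1 / 2, 0, 1 / 2} : Set ℝ) := by
    simp only [Set.mem_insert_iff, Set.mem_singleton_iff]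
    rcases h with h | h <;> rcases h i with hi | hi <;> rcases h j with hj | hj <;>
      rw [hi, hj] <;> push_cast
    · right; left; ring
    · right; right; ring
    · left; ring
    · right; left; ring
    · right; left; ring
    · left; ring
    · right; right; ring
    · right; left; ring
  exact ⟨key _ _ _, key _ _ _⟩

end SteinerInstance

/-! ### The descent step for embeddings. -/

open SteinerInstance in
theorem mainTheorem3 {V : Type*} [Finite V] (I : SteinerInstance V) (hI : I.IsIntegral)
    (π : V → ℝ × ℝ) (hfeas : I.IsFeasible π) (hhalf : IsHalfIntegral π)
    (hnot : ¬ I.IsOptimal π) :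
    ∃ π' : V → ℝ × ℝ, I.IsFeasible π' ∧ IsHalfIntegral π' ∧
      (∀ v, π v - π' v ∈
        ({-1 / 2, 0, 1 / 2} : Set ℝ) ×ˢ ({-1 / 2, 0, 1 / 2} : Set ℝ)) ∧
      I.cost π' ≤ I.cost π - 1 / 2 := by
  obtain ⟨σ, hσ, hlt⟩ : ∃ σ, I.IsFeasible σ ∧ I.cost σ < I.cost π := by
    by_contra! h
    exact hnot ⟨hfeas, h⟩
  have := Fintype.ofFinite I.S.edgeSet
  obtain ⟨f, hf⟩ := I.exists_orientation
  have hcost (τ : V → ℝ × ℝ) : totalTravel f (I.axisPotential τ) = 2 * I.cost τ := by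
    rw [I.cost_eq_sum (fun e => (hf e).1), Finset.mul_sum]
    exact Finset.sum_congr rfl fun e _ => I.travel_axisPotential_of_isParent τ (hf e).2
  choose p hp using I.exists_int_axisPotential hhalf
  have hp : I.axisPotential π = fun i => (p i : ℝ) := funext hp
  obtain ⟨p', hlt', hmove, hdiff⟩ := exists_unit_descent (totalTravel f) p (I.axisPotential σ)
    (by rw [← hp, hcost, hcost]; linarith)
  have hfeas' : I.IsFeasiblePotential fun i => (p' i : ℝ) :=
    .of_difference hI (hp ▸ hfeas.isFeasiblePotential) hσ.isFeasiblePotential hdiff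
  have hr : π I.r = I.p ⟨I.r, I.r_mem⟩ := hfeas.1 ⟨I.r, I.r_mem⟩
  have hπ : π = embeddingOf (I.p ⟨I.r, I.r_mem⟩) fun i => (p i : ℝ) := by
    rw [← hr, ← hp, I.embeddingOf_axisPotential]
  refine ⟨_, hfeas'.isFeasible, isHalfIntegral_embeddingOf (hI.1 _) p', fun v => ?_, ?_⟩
  · rw [hπ]
    exact embeddingOf_sub_mem hmove v
  · have hle : 2 * I.cost (embeddingOf (I.p ⟨I.r, I.r_mem⟩) fun i => (p' i : ℝ)) ≤
        totalTravel f fun i => (p' i : ℝ) := by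
      rw [I.cost_eq_sum (fun e => (hf e).1), Finset.mul_sum]
      exact Finset.sum_le_sum fun e _ => I.l1Norm_embeddingOf_le hfeas'.isMonotone _ (hf e).2
    have hc := hcost π
    rw [hp] at hc
    obtain ⟨n, hn⟩ := totalTravel_intCast f p
    obtain ⟨n', hn'⟩ := totalTravel_intCast f p'
    rw [hn, hn'] at hlt'
    -- A strict decrease between integers is at least 1, that is 1/2 in cost.
    have : (n' : ℝ) + 1 ≤ n := by exact_mod_cast hlt'
    linarith
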